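/- **Model.** A finite set $\mathcal R$ of anonymous, oblivious, deterministic, disoriented point robots in the plane acts in fully synchronous Look-Compute-Move (LCM) cycles. In each cycle a robot sees the set of positions of the robots within distance $1$ in its own coordinate system (centred at itself, arbitrarily rotated, with common unit length and handedness), computes a target from this view alone by the common protocol, and moves there; a robot moves by at most distance $1$ per cycle. **Drawing formations.** A *drawing hull* $H=(a,\vec d,\phi,\Delta)$ with $\|\vec d\|_2=1$, $\phi\in(0,\pi/3]$, $\Delta\in(0,1]$ is the set consisting of $a$ and all $x\neq a$ with $\operatorname{dist}(x,a)\le\Delta$ and counterclockwise angle $\angle(\vec d,x-a)\in[0,\phi)$. In a configuration, the *drawing formation* $F$ with hull $H$ consists of the robots in $H$ (its state robots); $F$ is *anchored* in $a$, its *size* is the number of its state robots and its *state* is the set of their positions. Let $\epsilon>0$ and let $\vec d_\bot$ be $\vec d$ rotated counterclockwise by $\pi/2$. Put $$L_F=\{a\}\cup\{a+(1+2i)\epsilon\vec d+2j\epsilon\vec d_\bot : i,j\in\mathbb N_0\}$$ intersected with $H$. An *$\epsilon$-granular state* is a set $S\cup T$ with $S\subseteq L_F$ and $T=\{a,a+\epsilon\vec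 d,a+(1+2i)\epsilon\vec d\}$ for some integer $1\le i\le\lfloor(\Delta/\epsilon-1)/2\rfloor$; $F$ is *$\epsilon$-granular* if its state is. Let $A_F^\ell$ be the set of $\epsilon$-granular states with exactly $\ell$ positions. Fix an arbitrary repetition-free enumeration of every $A_F^\ell$ that depends only on the positions relative to the hull (i.e. it commutes with translations and rotations); its $i$-th element ($1\le i\le|A_F^\ell|$) is the *$i$-th state* of size $\ell$. **Drawing paths.** Let $P\subset\mathbb R^2$ be a finite pattern. A sequence $\boldsymbol v=(v_j)_{j=1}^k$, $k\ge1$, of points of $\mathbb R^2$ (known to the robots together with $P$) is a *$\delta$-drawing path* of $P$ if every $p\in P$ has distance at most $1-\delta$ to some $v_j$ and $\operatorname{dist}(v_j,v_{j+1})\le 1-\delta$ for $1\le j<k$. Let $\operatorname{cov}(v_j)$ be the set of $p\in P$ for which $j$ is the largest index with $\operatorname{dist}(p,v_j)\le1-\delta$. The *tail* of $\boldsymbol v$ is its longest suffix $(v_j)_{j=s}^k$ with $\sum_{j=s}^k|\operatorname{cov}(v_j)|<4$, and $\operatorname{cov}(\operatorname{tail}(\boldsymbol v))$ is the union of $\operatorname{cov}(v_j)$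 over its vertices. An $\epsilon$-granular drawing formation $F$ of diameter $\Delta$ is *compatible* with $\boldsymbol v$ if 1. any two distinct points of $P$ have distance greater than $\epsilon$, and $\Delta\le\delta$; 2. whenever $s<t$ and $\operatorname{cov}(v_j)=\emptyset$ for all $s\le j<t$, the number $t-s+1$ of vertices from $v_s$ to $v_t$ is at most $|A_F^4|$; 3. the tail has at most $|A_F^3|$ vertices; 4. $|\operatorname{cov}(\operatorname{tail}(\boldsymbol v))|=3$, and all points of $\operatorname{cov}(\operatorname{tail}(\boldsymbol v))$ have distance at most $1$ from $v_k$. **Lemma.** Let $\boldsymbol v$ be a $\delta$-drawing path of $P$, and let the initial configuration consist of exactly the $|P|$ robots of a drawing formation $F$ with hull $(v_1,\vec d,\phi,\Delta)$ that has size $|P|$, is in its first state (of size $|P|$), and is compatible with $\boldsymbol v$. Assume moreover that $\Delta+\epsilon\le1-\delta$ and $|L_F|\ge|P|+2$. Let $D_j=\operatorname{cov}(v_j)$ if $v_j$ is not in the tail and $D_j=\emptyset$ if it is. Put $f_i=|P\setminus\bigcup_{j<i}D_j|$, and let $c_i$ be one plus the number of consecutive vertices directly before $v_i$ with $D_j=\emptyset$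 (i.e. the largest $m+1$ with $0\le m<i$ and $D_{i-m}=\dots=D_{i-1}=\emptyset$). Then there is a protocol, depending only on $P,\boldsymbol v,\epsilon,\delta$, the hull parameters (for $\vec d$: its direction relative to $P$) and the enumeration of states, such that, however the local coordinate systems are oriented in each cycle: * $F$ traverses $\boldsymbol v$ by one edge per LCM cycle: for every $1\le i\le k$, after $i-1$ cycles the drawing formation with hull $(v_i,\vec d,\phi,\Delta)$ has size $f_i$ and is in its $c_i$-th state (of size $f_i$); * in the cycle leading from $v_i$ to $v_{i+1}$ ($1\le i<k$), the state robots at $v_{i+1}$ are among those at $v_i$, the other state robots at $v_i$ (the dropped ones) are placed one on each coordinate of $D_i$, and all robots that were not state robots at $v_i$ stay where they are. Moreover the states encode the progress: the pairs $(f_i,c_i)$, $1\le i\le k$, are pairwise distinct. -/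

import Mathlib

/-! The plane is `ℂ` with its Euclidean metric; multiplication by `Complex.I` is the
counterclockwise rotation by `π / 2`. -/

noncomputable section

namespace Drawing

attribute [local instance] Classical.propDecidable

/-! ### Robots: oblivious, disoriented (common chirality and unit), viewing range 1, synchronous -/

/-- A deterministic oblivious protocol: the set of robot positions a robot sees, in its own
coordinate system (whose origin is the robot), determines the vector it moves by, again in its own
coordinate system. At most distance 1 is travelled per cycle. -/
structure Protocol where
  compute : Set ℂ → ℂ
  norm_compute_le : ∀ V, ‖compute V‖ ≤ 1

variable {ι : Type*}

/-- What robot `r` sees: all robots within distance 1, in the coordinate system centred at `r` and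
rotated by `u`. -/
def view (pos : ι → ℂ) (r : ι) (u : Circle) : Set ℂ :=
  {w | ∃ r', dist (pos r') (pos r) ≤ 1 ∧ w = (u : ℂ) * (pos r' - pos r)}

/-- One fully synchronous Look-Compute-Move cycle, where robot `r` uses a coordinate system
rotated by `u r`. -/
def lcmCycle (A : Protocol) (pos : ι → ℂ) (u : ι → Circle) : ι → ℂ :=
  fun r => pos r + ((u r)⁻¹ : Circle) * A.compute (view pos r (u r))

/-- `pos t r` is the position of robot `r` after `t` cycles; the orientations of the local
coordinate systems are arbitrary and may differ between robots and between cycles. -/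
def IsExecution (A : Protocol) (pos : ℕ → ι → ℂ) : Prop :=
  ∀ t, ∃ u : ι → Circle, pos (t + 1) = lcmCycle A (pos t) u

/-! ### Drawing hulls and drawing formations -/

structure DrawingHull where
  anchor : ℂ
  dir : ℂ
  span : ℝ
  diam : ℝ
  norm_dir : ‖dir‖ = 1
  span_pos : 0 < span
  span_le : span ≤ Real.pi / 3
  diam_pos : 0 < diam
  diam_le : diam ≤ 1

namespace DrawingHull

/-- The points `x` with `dist x a ≤ Δ` such that the counterclockwise angle from the direction to
`x - a` lies in `[0, φ)` (the anchor `a` included). -/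
def region (H : DrawingHull) : Set ℂ :=
  {x | ∃ r θ : ℝ, 0 ≤ r ∧ r ≤ H.diam ∧ 0 ≤ θ ∧ θ < H.span ∧
    x = H.anchor + r * Complex.exp (θ * Complex.I) * H.dir}

/-- The same hull translated to the anchor `p`. -/
def moveTo (H : DrawingHull) (p : ℂ) : DrawingHull := { H with anchor := p }

end DrawingHull

/-- The state robots of the drawing formation with hull `H`: all robots inside the hull. -/
def stateRobots (pos : ι → ℂ) (H : DrawingHull) : Set ι := {r | pos r ∈ H.region}

/-- The state of the drawing formation with hull `H`. -/
def formationState (pos : ι → ℂ) (H : DrawingHull) : Set ℂ := pos '' stateRobots pos H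

/-- The drawing formation with hull `H` in configuration `pos` moves to `p'` in the next
configuration `pos'`: the formation there consists of state robots of the old one. -/
def FormationMoves (pos pos' : ι → ℂ) (H : DrawingHull) (p' : ℂ) : Prop :=
  stateRobots pos' (H.moveTo p') ⊆ stateRobots pos H

/-! ### Granular states -/

def granularLocations (ε : ℝ) (H : DrawingHull) : Set ℂ :=
  ({H.anchor} ∪ {x | ∃ i j : ℕ, x = H.anchor + ((1 + 2 * i : ℝ) * ε : ℝ) * H.dir
    + ((2 * j : ℝ) * ε : ℝ) * (Complex.I * H.dir)}) ∩ H.region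

/-- The possible position sets of the three defining robots. -/
def definingSets (ε : ℝ) (H : DrawingHull) : Set (Set ℂ) :=
  {T | ∃ i : ℕ, 1 ≤ i ∧ (i : ℤ) ≤ ⌊(H.diam / ε - 1) / 2⌋ ∧
    T = {H.anchor, H.anchor + (ε : ℂ) * H.dir,
      H.anchor + ((1 + 2 * i : ℝ) * ε : ℝ) * H.dir}}

/-- The `ε`-granular states. -/
def granularStates (ε : ℝ) (H : DrawingHull) : Set (Set ℂ) :=
  {X | ∃ S T, S ⊆ granularLocations ε H ∧ T ∈ definingSets ε H ∧ X = S ∪ T}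

/-- The `ε`-granular states of `ℓ` robots. -/
def granularStatesOfSize (ε : ℝ) (H : DrawingHull) (ℓ : ℕ) : Set (Set ℂ) :=
  {X ∈ granularStates ε H | X.ncard = ℓ}

/-- `e H ℓ 1, e H ℓ 2, …` enumerates the `ε`-granular states of size `ℓ` of the hull `H` without
repetition, and depends only on relative positions: hulls that differ by a rotation and a
translation have their states enumerated in the same way. -/
structure IsStateEnumeration (ε : ℝ) (e : DrawingHull → ℕ → ℕ → Set ℂ) : Prop where
  bijOn : ∀ H ℓ, Set.BijOn (e H ℓ) (Set.Icc 1 (granularStatesOfSize ε H ℓ).ncard)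
    (granularStatesOfSize ε H ℓ)
  relative : ∀ H H' : DrawingHull, H.span = H'.span → H.diam = H'.diam →
    ∀ ℓ, ∀ i ∈ Set.Icc 1 (granularStatesOfSize ε H ℓ).ncard,
      e H' ℓ i = (fun x => H'.anchor + H'.dir / H.dir * (x - H.anchor)) '' e H ℓ i

/-- In configuration `pos`, the drawing formation with hull `H` has size `ℓ` and is in its
`i`-th state. -/
def IsInState (ε : ℝ) (e : DrawingHull → ℕ → ℕ → Set ℂ) (pos : ι → ℂ) (H : DrawingHull)
    (ℓ i : ℕ) : Prop :=
  (stateRobots pos H).ncard = ℓ ∧ i ∈ Set.Icc 1 (granularStatesOfSize ε H ℓ).ncard ∧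
    formationState pos H = e H ℓ i

/-! ### Drawing paths -/

variable {k : ℕ}

/-- The metric conditions on a `δ`-drawing path `v` with `k` vertices of the pattern `P`. -/
structure IsDrawingPath (δ : ℝ) (P : Finset ℂ) (v : Fin k → ℂ) : Prop where
  near : ∀ p ∈ P, ∃ j, dist p (v j) ≤ 1 - δ
  edge : ∀ j j' : Fin k, (j' : ℕ) = j + 1 → dist (v j) (v j') ≤ 1 - δ

/-- The coordinates covered by the vertex `v j`. -/
def cov (δ : ℝ) (P : Finset ℂ) (v : Fin k → ℂ) (j : Fin k) : Finset ℂ :=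
  {p ∈ P | dist p (v j) ≤ 1 - δ ∧ ∀ j', j < j' → ¬ dist p (v j') ≤ 1 - δ}

/-- The indices of the longest suffix whose vertices cover fewer than 4 coordinates in total. -/
def tail (δ : ℝ) (P : Finset ℂ) (v : Fin k → ℂ) : Finset (Fin k) :=
  {s | ∑ j ∈ Finset.Ici s, (cov δ P v j).card < 4}

/-- The coordinates covered by the tail. -/
def covTail (δ : ℝ) (P : Finset ℂ) (v : Fin k → ℂ) : Finset ℂ :=
  (tail δ P v).biUnion (cov δ P v)

/-- In configuration `pos`, the drawing formation with hull `H` is `ε`-granular and compatible with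
the `δ`-drawing path `v` of `P`. In `body`, `t - s + 1` is the number of vertices on the
subpath from `v s` to `v t`. -/
structure Compatible [NeZero k] (ε δ : ℝ) (P : Finset ℂ) (v : Fin k → ℂ) (pos : ι → ℂ)
    (H : DrawingHull) : Prop where
  granular : formationState pos H ∈ granularStates ε H
  mindist : ∀ p ∈ P, ∀ q ∈ P, p ≠ q → ε < dist p q
  diam_le : H.diam ≤ δ
  body : ∀ s t : Fin k, s < t → (∀ j, s ≤ j → j < t → cov δ P v j = ∅) →
    (t : ℕ) - (s : ℕ) + 1 ≤ (granularStatesOfSize ε H 4).ncard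
  tail_length : (tail δ P v).card ≤ (granularStatesOfSize ε H 3).ncard
  tail_card : (covTail δ P v).card = 3
  tail_near : ∀ p ∈ covTail δ P v, ∀ j : Fin k, (j : ℕ) + 1 = k → dist p (v j) ≤ 1

/-! ### Drops and progress along the path -/

/-- The coordinates at which a robot is dropped when `v j` is left: those covered by `v j` if
`v j` is not in the tail, none otherwise. -/
def dropSet (δ : ℝ) (P : Finset ℂ) (v : Fin k → ℂ) (j : Fin k) : Finset ℂ :=
  if j ∈ tail δ P v then ∅ else cov δ P v j

/-- The number of coordinates at which no robot has been dropped on arrival at `v i`. -/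
def remaining (δ : ℝ) (P : Finset ℂ) (v : Fin k → ℂ) (i : Fin k) : ℕ :=
  (P \ (Finset.Iio i).biUnion (dropSet δ P v)).card

/-- One plus the number of consecutive vertices directly before `v i` at which nothing is
dropped. -/
def counter (δ : ℝ) (P : Finset ℂ) (v : Fin k → ℂ) (i : Fin k) : ℕ :=
  ({j | j < i ∧ ∀ l, j ≤ l → l < i → dropSet δ P v l = ∅} : Finset (Fin k)).card + 1

end Drawing

end

noncomputable section

namespace Drawing

attribute [local instance] Classical.propDecidable

/-! ### Geometry of drawing hulls -/

namespace DrawingHull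

/-! The core is that one view of a state robot reveals everything. A span of at most π/3 keeps the
diameter of the hull at most `Δ ≤ 1`, so each state robot sees the whole state. Among granular
locations only the anchor `a` and `a + ε d` are at distance exactly `ε`. Dropped robots cannot
imitate this pair: they lie on coordinates further than `1 - δ ≥ Δ + ε` from the current vertex, and
further than `ε` from each other. The third defining robot tells which robot of the pair is the
anchor. This fixes the local frame, the place in the hull and the state (`IsSeparated.recognize`).

The state gives its size and its index. The size never increases along the path; while it is
constant nothing is dropped and the counter strictly grows. So the pair (size, counter) determines
the vertex (`injective_remaining_counter`), and the whole configuration is known. A protocol may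
then follow any prescribed bijection from the old state onto the new state together with the drop
coordinates (`exists_protocol`, `IsTraversable.exists_step`). Its moves have length at most `(1 - δ)
+ Δ ≤ 1`.

It remains that every required index exists. Before the tail the size is at least 4, and
compatibility bounds the counter by the number of states of size 4, which is minimal among the sizes
that occur (`ncard_granularStatesOfSize_four_le`). In the tail the size is 3 and the counter is at
most the length of the tail. Induction over the cycles finishes the proof. -/

theorem dir_ne_zero (H : DrawingHull) : H.dir ≠ 0 := by
  intro h
  simpa [h] using H.norm_dir

theorem dist_anchor_le (H : DrawingHull) {x : ℂ} (hx : x ∈ H.region) :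
    dist x H.anchor ≤ H.diam := by
  obtain ⟨r, θ, hr, hrd, -, -, rfl⟩ := hx
  simpa [dist_eq_norm, H.norm_dir, abs_of_nonneg hr, Complex.norm_exp_ofReal_mul_I] using hrd

/-- Law of cosines: two directions in the hull differ by at most π/3, so the cosine is at least 1/2
and `r² + s² - 2rs cos ≤ r² + s² - rs ≤ max(r, s)²`. Hence state robots see each other. -/
theorem dist_le_of_mem_region (H : DrawingHull) {x y : ℂ} (hx : x ∈ H.region)
    (hy : y ∈ H.region) : dist x y ≤ H.diam := by
  obtain ⟨r, θ, hr, hrd, hθ, hθ', rfl⟩ := hx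
  obtain ⟨s, η, hs, hsd, hη, hη', rfl⟩ := hy
  have hcos : 1 / 2 ≤ Real.cos (θ - η) := by
    rw [← Real.cos_pi_div_three, ← Real.cos_abs (θ - η)]
    have h := H.span_le
    have habs : |θ - η| ≤ Real.pi / 3 := abs_le.2 ⟨by linarith, by linarith⟩
    exact Real.cos_le_cos_of_nonneg_of_le_pi (abs_nonneg _) (by linarith [Real.pi_pos]) habs
  have hn : dist (H.anchor + r * Complex.exp (θ * Complex.I) * H.dir)
      (H.anchor + s * Complex.exp (η * Complex.I) * H.dir) =
      ‖(r * Complex.exp (θ * Complex.I) - s * Complex.exp (η * Complex.I) : ℂ)‖ := by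
    rw [dist_eq_norm, add_sub_add_left_eq_sub, ← sub_mul, norm_mul, H.norm_dir, mul_one]
  have hsq : ‖(r * Complex.exp (θ * Complex.I) - s * Complex.exp (η * Complex.I) : ℂ)‖ ^ 2 =
      r ^ 2 + s ^ 2 - 2 * (r * s) * Real.cos (θ - η) := by
    rw [Complex.sq_norm, Complex.normSq_apply]
    simp only [Complex.sub_re, Complex.sub_im, Complex.re_ofReal_mul, Complex.im_ofReal_mul,
      Complex.exp_ofReal_mul_I_re, Complex.exp_ofReal_mul_I_im, Real.cos_sub]
    linear_combination r ^ 2 * Real.sin_sq_add_cos_sq θ + s ^ 2 * Real.sin_sq_add_cos_sq η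
  rw [hn]
  refine abs_le_of_sq_le_sq' ?_ H.diam_pos.le |>.2
  rw [hsq]
  have hmul := mul_le_mul_of_nonneg_left hcos (mul_nonneg hr hs)
  rcases le_total r s with h | h
  · nlinarith [mul_nonneg hr (sub_nonneg.2 h)]
  · nlinarith [mul_nonneg hs (sub_nonneg.2 h)]

theorem re_div_dir_nonneg (H : DrawingHull) {x : ℂ} (hx : x ∈ H.region) :
    0 ≤ ((x - H.anchor) / H.dir).re := by
  obtain ⟨r, θ, hr, -, hθ, hθ', rfl⟩ := hx
  rw [add_sub_cancel_left, mul_div_cancel_right₀ _ H.dir_ne_zero, Complex.re_ofReal_mul,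
    Complex.exp_ofReal_mul_I_re]
  have h := H.span_le
  exact mul_nonneg hr (Real.cos_nonneg_of_mem_Icc
    ⟨by linarith [Real.pi_pos], by linarith [Real.pi_pos]⟩)

theorem anchor_mem_region (H : DrawingHull) : H.anchor ∈ H.region :=
  ⟨0, 0, le_rfl, H.diam_pos.le, le_rfl, H.span_pos, by simp⟩

theorem anchor_add_mem_region (H : DrawingHull) {r : ℝ} (hr : 0 ≤ r) (hrd : r ≤ H.diam) :
    H.anchor + (r : ℂ) * H.dir ∈ H.region :=
  ⟨r, 0, hr, hrd, le_rfl, H.span_pos, by simp⟩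

theorem mem_region_moveTo (H : DrawingHull) (p x : ℂ) :
    x ∈ (H.moveTo p).region ↔ x + (H.anchor - p) ∈ H.region := by
  simp only [region, moveTo, Set.mem_ofPred_eq]
  refine exists_congr fun r => exists_congr fun θ => and_congr_right fun _ =>
    and_congr_right fun _ => and_congr_right fun _ => and_congr_right fun _ => ?_
  constructor <;> intro h
  · rw [h]; ring
  · linear_combination h

theorem sq_add_sq_eq_one (H : DrawingHull) {ε m n : ℝ} (hε : 0 < ε)
    (h : ‖((m * ε : ℝ) : ℂ) * H.dir + ((n * ε : ℝ) : ℂ) * (Complex.I * H.dir)‖ = ε) :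
    m ^ 2 + n ^ 2 = 1 := by
  have h1 : ((m * ε : ℝ) : ℂ) * H.dir + ((n * ε : ℝ) : ℂ) * (Complex.I * H.dir) =
      ((m : ℂ) + (n : ℂ) * Complex.I) * (ε : ℂ) * H.dir := by
    push_cast
    ring
  rw [h1, norm_mul, norm_mul, H.norm_dir, mul_one, Complex.norm_real, Real.norm_eq_abs,
    abs_of_pos hε, mul_eq_right₀ hε.ne', Complex.norm_add_mul_I, Real.sqrt_eq_one] at h
  exact h

end DrawingHull

/-! ### Granular states: characterization, rigidity, translation -/

section Granular

variable {ε : ℝ} {H : DrawingHull}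

theorem granularLocations_subset_region : granularLocations ε H ⊆ H.region :=
  Set.inter_subset_right

/-- The possible positions of the third defining robot. -/
def markers (ε : ℝ) (H : DrawingHull) : Set ℂ :=
  {t | ∃ i : ℕ, 1 ≤ i ∧ (1 + 2 * i) * ε ≤ H.diam ∧
    t = H.anchor + ((1 + 2 * i : ℝ) * ε : ℝ) * H.dir}

theorem le_floor_iff (hε : 0 < ε) (i : ℕ) :
    (i : ℤ) ≤ ⌊(H.diam / ε - 1) / 2⌋ ↔ (1 + 2 * i) * ε ≤ H.diam := by
  rw [Int.le_floor, le_div_iff₀ two_pos, le_sub_iff_add_le, le_div_iff₀ hε]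
  push_cast
  ring_nf

theorem markers_subset (hε : 0 < ε) : markers ε H ⊆ granularLocations ε H := by
  rintro t ⟨i, -, hi, rfl⟩
  refine ⟨Or.inr ⟨i, 0, by simp⟩, ?_⟩
  exact H.anchor_add_mem_region (by positivity) hi

theorem anchor_mem_granularLocations : H.anchor ∈ granularLocations ε H :=
  ⟨Or.inl rfl, H.anchor_mem_region⟩

theorem anchor_add_mem_granularLocations (hε : 0 < ε) (hd : ε ≤ H.diam) :
    H.anchor + (ε : ℂ) * H.dir ∈ granularLocations ε H :=
  ⟨Or.inr ⟨0, 0, by simp⟩, H.anchor_add_mem_region hε.le hd⟩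

theorem le_diam_of_marker (hε : 0 < ε) {t : ℂ} (ht : t ∈ markers ε H) : ε ≤ H.diam := by
  obtain ⟨i, -, hi, -⟩ := ht
  have : 0 ≤ (i : ℝ) * ε := by positivity
  linarith

/-- The defining robots stand on granular locations themselves, so `S` can absorb `T`. This turns
states into subsets of a fixed set that contain two given points and hit a third set, a form suited
to counting. -/
theorem mem_granularStates_iff (hε : 0 < ε) (X : Set ℂ) :
    X ∈ granularStates ε H ↔ X ⊆ granularLocations ε H ∧ H.anchor ∈ X ∧
      H.anchor + (ε : ℂ) * H.dir ∈ X ∧ ∃ t ∈ markers ε H, t ∈ X := by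
  constructor
  · rintro ⟨S, T, hS, ⟨i, hi, hi', rfl⟩, rfl⟩
    have hm : H.anchor + ((1 + 2 * i : ℝ) * ε : ℝ) * H.dir ∈ markers ε H :=
      ⟨i, hi, (le_floor_iff hε i).1 hi', rfl⟩
    refine ⟨Set.union_subset hS ?_, by simp, by simp, _, hm, by simp⟩
    rintro x (rfl | rfl | rfl)
    · exact anchor_mem_granularLocations
    · exact anchor_add_mem_granularLocations hε (le_diam_of_marker hε hm)
    · exact markers_subset hε hm
  · rintro ⟨hX, ha, hb, t, ⟨i, hi, hi', rfl⟩, ht⟩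
    refine ⟨X, _, hX, ⟨i, hi, (le_floor_iff hε i).2 hi', rfl⟩, ?_⟩
    refine (Set.union_eq_left.2 ?_).symm
    rintro x (rfl | rfl | rfl) <;> assumption

/-- The anchor and the location next to it form the only pair of granular locations at
distance `ε`. -/
theorem eq_of_dist_eq (hε : 0 < ε) {x y : ℂ} (hx : x ∈ granularLocations ε H)
    (hy : y ∈ granularLocations ε H) (h : dist x y = ε) :
    (x = H.anchor ∧ y = H.anchor + (ε : ℂ) * H.dir) ∨
      (y = H.anchor ∧ x = H.anchor + (ε : ℂ) * H.dir) := by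
  -- In units of `ε`, an odd square plus an even square equals 1 only for `1² + 0²`.
  have key : ∀ i j : ℕ, dist (H.anchor + ((1 + 2 * i : ℝ) * ε : ℝ) * H.dir
      + ((2 * j : ℝ) * ε : ℝ) * (Complex.I * H.dir)) H.anchor = ε → i = 0 ∧ j = 0 := by
    intro i j hd
    have h3 : (1 + 2 * i : ℝ) ^ 2 + (2 * j : ℝ) ^ 2 = 1 := by
      refine H.sq_add_sq_eq_one hε ?_
      rwa [dist_eq_norm, add_assoc, add_sub_cancel_left] at hd
    have h4 : (1 + 2 * i) ^ 2 + (2 * j) ^ 2 = 1 := by exact_mod_cast h3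
    constructor <;> nlinarith
  have hone : H.anchor + ((1 + 2 * (0 : ℕ) : ℝ) * ε : ℝ) * H.dir
      + ((2 * (0 : ℕ) : ℝ) * ε : ℝ) * (Complex.I * H.dir) = H.anchor + (ε : ℂ) * H.dir := by
    simp
  rcases hx.1 with rfl | ⟨i, j, rfl⟩ <;> rcases hy.1 with rfl | ⟨i', j', rfl⟩
  · simp [hε.ne] at h
  · rw [dist_comm] at h
    obtain ⟨rfl, rfl⟩ := key _ _ h
    exact Or.inl ⟨rfl, hone⟩
  · obtain ⟨rfl, rfl⟩ := key _ _ h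
    exact Or.inr ⟨rfl, hone⟩
  · exfalso
    -- Away from the anchor both coordinate differences are even, so the squared distance in units
    -- of `ε` is a multiple of 4.
    have h3 : (2 * i - 2 * i' : ℝ) ^ 2 + (2 * j - 2 * j' : ℝ) ^ 2 = 1 := by
      refine H.sq_add_sq_eq_one hε ?_
      rw [dist_eq_norm] at h
      refine Eq.trans ?_ h
      congr 1
      push_cast
      ring
    have h4 : (2 * i - 2 * i' : ℤ) ^ 2 + (2 * j - 2 * j' : ℤ) ^ 2 = 1 := by exact_mod_cast h3
    have h5 : (2 : ℤ) * (2 * ((i - i') ^ 2 + (j - j') ^ 2)) = 1 := by linarith [h4]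
    omega

theorem mem_granularLocations_moveTo (p x : ℂ) :
    x ∈ granularLocations ε (H.moveTo p) ↔ x + (H.anchor - p) ∈ granularLocations ε H := by
  refine and_congr (or_congr ?_ ?_) (H.mem_region_moveTo p x)
  · simp only [DrawingHull.moveTo, Set.mem_singleton_iff]
    constructor <;> intro h
    · rw [h]; ring
    · linear_combination h
  · refine exists_congr fun i => exists_congr fun j => ?_
    simp only [DrawingHull.moveTo]
    constructor <;> intro h
    · rw [h]; ring
    · linear_combination h

theorem mem_markers_moveTo (p x : ℂ) :
    x ∈ markers ε (H.moveTo p) ↔ x + (H.anchor - p) ∈ markers ε H := by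
  refine exists_congr fun i => and_congr_right fun _ => and_congr_right fun _ => ?_
  simp only [DrawingHull.moveTo]
  constructor <;> intro h
  · rw [h]; ring
  · linear_combination h

/-- Every ingredient of a state is defined relative to the anchor. The double preimage pulls `X`
back along the translation from the old anchor to `p`; being a bijection, it preserves the number of
states. -/
theorem granularStatesOfSize_moveTo (hε : 0 < ε) (p : ℂ) (ℓ : ℕ) :
    granularStatesOfSize ε (H.moveTo p) ℓ =
      Set.preimage (Equiv.addRight (p - H.anchor)) ⁻¹' granularStatesOfSize ε H ℓ := by
  ext X
  simp only [granularStatesOfSize, Set.mem_ofPred_eq, Set.mem_preimage,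
    mem_granularStates_iff hε, Equiv.coe_addRight]
  refine and_congr (and_congr ?_ (and_congr ?_ (and_congr ?_ ?_))) ?_
  · constructor
    · intro h x hx
      have := (mem_granularLocations_moveTo p _).1 (h hx)
      rwa [show x + (p - H.anchor) + (H.anchor - p) = x by ring] at this
    · intro h x hx
      rw [mem_granularLocations_moveTo]
      exact h (by rwa [Set.mem_preimage, show x + (H.anchor - p) + (p - H.anchor) = x by ring])
  · simp [DrawingHull.moveTo]
  · simp [DrawingHull.moveTo, show H.anchor + (ε : ℂ) * H.dir + (p - H.anchor) =
      p + ε * H.dir by ring]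
  · constructor
    · rintro ⟨t, ht, htX⟩
      exact ⟨_, (mem_markers_moveTo p t).1 ht, by
        rwa [show t + (H.anchor - p) + (p - H.anchor) = t by ring]⟩
    · rintro ⟨t, ht, htX⟩
      refine ⟨_, (mem_markers_moveTo p _).2 ?_, htX⟩
      rwa [show t + (p - H.anchor) + (H.anchor - p) = t by ring]
  · rw [← Equiv.coe_addRight, Set.ncard_preimage_of_injective_subset_range
      (Equiv.injective _) (by rw [Equiv.range_eq_univ]; exact Set.subset_univ _)]

theorem ncard_granularStatesOfSize_moveTo (hε : 0 < ε) (p : ℂ) (ℓ : ℕ) :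
    (granularStatesOfSize ε (H.moveTo p) ℓ).ncard = (granularStatesOfSize ε H ℓ).ncard := by
  rw [granularStatesOfSize_moveTo hε]
  exact Set.ncard_preimage_of_injective_subset_range
    (Set.preimage_injective.2 (Equiv.surjective _))
    fun X _ => (Set.preimage_surjective.2 (Equiv.injective _)) X

end Granular

/-! ### Counting states of a given size -/

section Counting

theorem le_choose_of_lt {n m : ℕ} (hm : 1 ≤ m) (hmn : m < n) : n ≤ n.choose m := by
  induction n with
  | zero => omega
  | succ n ih =>
    obtain ⟨m, rfl⟩ : ∃ m', m = m' + 1 := ⟨m - 1, by omega⟩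
    rw [Nat.choose_succ_succ']
    have hpos : 0 < n.choose m := Nat.choose_pos (by omega)
    rcases Nat.lt_or_ge (m + 1) n with h | h
    · have := ih h
      omega
    · obtain rfl : n = m + 1 := by omega
      simp

/-- The number of `m`-subsets of an `N`-set that hit a fixed subset whose complement has size `q`
is smallest for `m = 2` when `2 ≤ m ≤ N - 2`. -/
theorem choose_two_add_choose_le {N m q : ℕ} (hm : 2 ≤ m) (hmN : m + 2 ≤ N) (hq : q ≤ N) :
    N.choose 2 + q.choose m ≤ N.choose m + q.choose 2 := by
  -- `C(n, m) - C(n, 2)` is nondecreasing for `n ≥ m`: by Pascal its increment is `C(n, m - 1) - n ≥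
  -- 0`.
  have mono : ∀ n, m ≤ n → ∀ n', n ≤ n' →
      n'.choose 2 + n.choose m ≤ n'.choose m + n.choose 2 := by
    intro n hn n' hnn'
    induction n', hnn' using Nat.le_induction with
    | base => omega
    | succ l hl ih =>
      obtain ⟨m, rfl⟩ : ∃ m', m = m' + 1 := ⟨m - 1, by omega⟩
      have h2 : (l + 1).choose 2 = l + l.choose 2 := by
        rw [Nat.choose_succ_succ' l 1, Nat.choose_one_right]
      rw [h2, Nat.choose_succ_succ' l m]
      have := le_choose_of_lt (n := l) (m := m) (by omega) (by omega)
      omega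
  rcases le_or_gt m q with h | h
  · exact mono q h N hq
  · rw [Nat.choose_eq_zero_of_lt h]
    -- For `q < m` the comparison starts at `m + 2`, where the two binomials coincide.
    have hsymm : (m + 2).choose 2 = (m + 2).choose m := Nat.choose_symm_add.symm
    have := mono (m + 2) (by omega) N hmN
    omega

variable {α : Type*}

/-- The number of subsets of `L` of size `m + 2` that contain two fixed elements and hit a given
subset. -/
theorem ncard_subsets_hitting {L R : Set α} (hL : L.Finite) {a b : α} (hab : a ≠ b) (ha : a ∈ L)
    (hb : b ∈ L) (hRL : R ⊆ L) (haR : a ∉ R) (hbR : b ∉ R) (m : ℕ) :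
    {X : Set α | (X ⊆ L ∧ a ∈ X ∧ b ∈ X ∧ ∃ t ∈ R, t ∈ X) ∧ X.ncard = m + 2}.ncard +
      (L.ncard - 2 - R.ncard).choose m = (L.ncard - 2).choose m := by
  lift L to Finset α using hL
  lift R to Finset α using L.finite_toSet.subset hRL
  norm_cast at ha hb hRL haR hbR
  set M := (L.erase a).erase b with hM
  have hMcard : M.card = L.card - 2 := by
    rw [hM, Finset.card_erase_of_mem (Finset.mem_erase.2 ⟨hab.symm, hb⟩),
      Finset.card_erase_of_mem ha]
    rfl
  have hRM : R ⊆ M := fun t ht => Finset.mem_erase.2 ⟨fun h => hbR (h ▸ ht),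
    Finset.mem_erase.2 ⟨fun h => haR (h ▸ ht), hRL ht⟩⟩
  have haM : a ∉ M := by simp [hM]
  have hbM : b ∉ M := by simp [hM]
  have hML : M ⊆ L := fun x hx => Finset.mem_of_mem_erase (Finset.mem_of_mem_erase hx)
  -- Deleting `a` and `b` leaves an `m`-subset of `M`; it hits `R` exactly when it is not a subset
  -- of `M \ R`.
  have hset : {X : Set α | (X ⊆ L ∧ a ∈ X ∧ b ∈ X ∧ ∃ t ∈ (R : Set α), t ∈ X) ∧
      X.ncard = m + 2} = (fun Y : Finset α => ((insert a (insert b Y) : Finset α) : Set α)) ''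
        ((M.powersetCard m \ (M \ R).powersetCard m : Finset (Finset α)) : Set (Finset α)) := by
    ext X
    simp only [Set.mem_ofPred_eq, Set.mem_image, Finset.mem_coe, Finset.mem_sdiff,
      Finset.mem_powersetCard]
    constructor
    · rintro ⟨⟨hX, haX, hbX, t, htR, htX⟩, hc⟩
      lift X to Finset α using L.finite_toSet.subset hX
      norm_cast at hX haX hbX htR htX
      rw [Set.ncard_coe_finset] at hc
      have hb' : b ∈ X.erase a := Finset.mem_erase.2 ⟨hab.symm, hbX⟩
      refine ⟨(X.erase a).erase b, ⟨⟨?_, ?_⟩, ?_⟩, ?_⟩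
      · exact Finset.erase_subset_erase _ (Finset.erase_subset_erase _ hX)
      · rw [Finset.card_erase_of_mem hb', Finset.card_erase_of_mem haX, hc]
        rfl
      · rintro ⟨h, -⟩
        have htM := Finset.mem_erase.1 (hRM htR)
        have := h (Finset.mem_erase.2 ⟨htM.1,
          Finset.mem_erase.2 ⟨(Finset.mem_erase.1 htM.2).1, htX⟩⟩)
        exact (Finset.mem_sdiff.1 this).2 htR
      · rw [Finset.insert_erase hb', Finset.insert_erase haX]
    · rintro ⟨Y, ⟨⟨hY, hc⟩, hYR⟩, rfl⟩
      have hbY : b ∉ Y := fun h => hbM (hY h)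
      have haY : a ∉ insert b Y := by
        simp only [Finset.mem_insert, not_or]
        exact ⟨hab, fun h => haM (hY h)⟩
      refine ⟨⟨?_, by simp, by simp, ?_⟩, ?_⟩
      · rw [Finset.coe_subset]
        intro x hx
        rcases Finset.mem_insert.1 hx with rfl | hx
        · exact ha
        rcases Finset.mem_insert.1 hx with rfl | hx
        · exact hb
        exact hML (hY hx)
      · by_contra! hno
        refine hYR ⟨fun x hx => Finset.mem_sdiff.2 ⟨hY hx, fun hxR => ?_⟩, hc⟩
        exact hno x (Finset.mem_coe.2 hxR) (by simp [hx])
      · rw [Set.ncard_coe_finset, Finset.card_insert_of_notMem haY,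
          Finset.card_insert_of_notMem hbY, hc]
  have hinj : Set.InjOn (fun Y : Finset α => ((insert a (insert b Y) : Finset α) : Set α))
      ((M.powersetCard m \ (M \ R).powersetCard m : Finset (Finset α)) : Set (Finset α)) := by
    have herase : ∀ Y ⊆ M, ((insert a (insert b Y)).erase a).erase b = Y := by
      intro Y hY
      have hbY : b ∉ Y := fun h => hbM (hY h)
      have haY : a ∉ insert b Y := by
        simp only [Finset.mem_insert, not_or]
        exact ⟨hab, fun h => haM (hY h)⟩
      rw [Finset.erase_insert haY, Finset.erase_insert hbY]
    intro Y hY Z hZ hYZ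
    have hY' := (Finset.mem_powersetCard.1 (Finset.mem_sdiff.1 hY).1).1
    have hZ' := (Finset.mem_powersetCard.1 (Finset.mem_sdiff.1 hZ).1).1
    rw [← herase Y hY', ← herase Z hZ', Finset.coe_injective hYZ]
  rw [hset, hinj.ncard_image, Set.ncard_coe_finset, Set.ncard_coe_finset,
    Set.ncard_coe_finset, ← hMcard, ← Finset.card_sdiff_of_subset hRM, ← Finset.card_powersetCard,
    ← Finset.card_powersetCard]
  exact Finset.card_sdiff_add_card_eq_card (Finset.powersetCard_mono Finset.sdiff_subset)

variable {ε : ℝ} {H : DrawingHull}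

theorem granularStatesOfSize_eq (hε : 0 < ε) (ℓ : ℕ) :
    granularStatesOfSize ε H ℓ = {X | (X ⊆ granularLocations ε H ∧ H.anchor ∈ X ∧
      H.anchor + (ε : ℂ) * H.dir ∈ X ∧ ∃ t ∈ markers ε H, t ∈ X) ∧ X.ncard = ℓ} := by
  ext X
  simp only [granularStatesOfSize, Set.mem_ofPred_eq, mem_granularStates_iff hε]

theorem anchor_ne (hε : 0 < ε) : H.anchor ≠ H.anchor + (ε : ℂ) * H.dir := by
  simp [hε.ne', H.dir_ne_zero]

theorem marker_ne (hε : 0 < ε) {t : ℂ} (ht : t ∈ markers ε H) :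
    t ≠ H.anchor ∧ t ≠ H.anchor + (ε : ℂ) * H.dir := by
  obtain ⟨i, hi, -, rfl⟩ := ht
  constructor
  · intro h
    have h1 : (((1 + 2 * i : ℝ) * ε : ℝ) : ℂ) = 0 :=
      (mul_eq_zero.1 (add_eq_left.1 h)).resolve_right H.dir_ne_zero
    have h2 : (1 + 2 * i : ℝ) * ε = 0 := by exact_mod_cast h1
    have : 0 < (1 + 2 * i : ℝ) * ε := by positivity
    linarith
  · intro h
    have h1 : (((1 + 2 * i : ℝ) * ε : ℝ) : ℂ) = ε :=
      mul_right_cancel₀ H.dir_ne_zero (add_left_cancel h)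
    have h2 : (1 + 2 * i : ℝ) * ε = ε := by exact_mod_cast h1
    have h3 : (1 : ℝ) ≤ i := by exact_mod_cast hi
    nlinarith

/-- For sizes between 4 and `|L| - 2`, there are at least as many states as of size 4. -/
theorem ncard_granularStatesOfSize_four_le (hε : 0 < ε) {ℓ : ℕ} (h4 : 4 ≤ ℓ)
    (hℓ : ℓ + 2 ≤ (granularLocations ε H).ncard) :
    (granularStatesOfSize ε H 4).ncard ≤ (granularStatesOfSize ε H ℓ).ncard := by
  rcases (markers ε H).eq_empty_or_nonempty with hR | ⟨t, ht⟩
  · rw [granularStatesOfSize_eq hε 4, hR]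
    simp
  have hfin : (granularLocations ε H).Finite := Set.finite_of_ncard_ne_zero (by omega)
  have hcount := ncard_subsets_hitting hfin (anchor_ne hε) anchor_mem_granularLocations
    (anchor_add_mem_granularLocations hε (le_diam_of_marker hε ht)) (markers_subset hε)
    (fun h => (marker_ne hε h).1 rfl) (fun h => (marker_ne hε h).2 rfl)
  have h2 := hcount 2
  have hm := hcount (ℓ - 2)
  rw [← granularStatesOfSize_eq hε] at h2 hm
  rw [Nat.sub_add_cancel (by omega : 2 ≤ ℓ)] at hm
  change (granularStatesOfSize ε H 4).ncard + _ = _ at h2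
  -- Two positions are forced, so size `ℓ` means `m = ℓ - 2` free ones among `N = |L| - 2`; `q`
  -- counts the free locations that are not markers.
  have := choose_two_add_choose_le (m := ℓ - 2) (N := (granularLocations ε H).ncard - 2)
    (q := (granularLocations ε H).ncard - 2 - (markers ε H).ncard) (by omega) (by omega) (by omega)
  omega

theorem granularStatesOfSize_finite (hL : (granularLocations ε H).Finite) (hε : 0 < ε) (ℓ : ℕ) :
    (granularStatesOfSize ε H ℓ).Finite := by
  rw [granularStatesOfSize_eq hε]
  exact hL.finite_subsets.subset fun X hX => hX.1.1

/-- A larger state can be thinned out to any size at least 3 while keeping its three defining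
positions. -/
theorem ncard_granularStatesOfSize_pos (hε : 0 < ε) (hL : (granularLocations ε H).Finite)
    {n f : ℕ} (hf : 3 ≤ f) (hfn : f ≤ n) (hn : (granularStatesOfSize ε H n).Nonempty) :
    1 ≤ (granularStatesOfSize ε H f).ncard := by
  refine (Set.ncard_pos (granularStatesOfSize_finite hL hε f)).2 ?_
  rw [granularStatesOfSize_eq hε] at hn ⊢
  obtain ⟨X, ⟨hX, ha, hb, t, htR, ht⟩, hc⟩ := hn
  have hsub : ({H.anchor, H.anchor + (ε : ℂ) * H.dir, t} : Set ℂ) ⊆ X := by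
    rintro x (rfl | rfl | rfl) <;> assumption
  have hthree : ({H.anchor, H.anchor + (ε : ℂ) * H.dir, t} : Set ℂ).ncard ≤ f := by
    have h1 := Set.ncard_insert_le H.anchor {H.anchor + (ε : ℂ) * H.dir, t}
    have h2 := Set.ncard_insert_le (H.anchor + (ε : ℂ) * H.dir) {t}
    rw [Set.ncard_singleton] at h2
    omega
  obtain ⟨Y, hY, hYX, hYc⟩ := Set.exists_subsuperset_card_eq hsub hthree (hc ▸ hfn)
  exact ⟨Y, ⟨hYX.trans hX, hY (by simp), hY (by simp), t, htR, hY (by simp)⟩, hYc⟩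

end Counting

/-! ### Drops, tail and counter along the path -/

section Path

variable {k : ℕ} {δ : ℝ} {P : Finset ℂ} {v : Fin k → ℂ}

theorem cov_subset (j : Fin k) : cov δ P v j ⊆ P := Finset.filter_subset _ _

theorem mem_cov {j : Fin k} {p : ℂ} : p ∈ cov δ P v j ↔
    p ∈ P ∧ dist p (v j) ≤ 1 - δ ∧ ∀ j', j < j' → ¬ dist p (v j') ≤ 1 - δ :=
  Finset.mem_filter

theorem eq_of_mem_cov {i j : Fin k} {p : ℂ} (hi : p ∈ cov δ P v i) (hj : p ∈ cov δ P v j) :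
    i = j := by
  rw [mem_cov] at hi hj
  rcases lt_trichotomy i j with h | h | h
  · exact absurd hj.2.1 (hi.2.2 j h)
  · exact h
  · exact absurd hi.2.1 (hj.2.2 i h)

theorem pairwiseDisjoint_cov (s : Set (Fin k)) : s.PairwiseDisjoint (cov δ P v) :=
  fun _ _ _ _ hij => Finset.disjoint_left.2 fun _ hi hj => hij (eq_of_mem_cov hi hj)

theorem dropSet_subset_cov (j : Fin k) : dropSet δ P v j ⊆ cov δ P v j := by
  unfold dropSet
  split_ifs <;> simp

theorem dropSet_of_notMem_tail {j : Fin k} (hj : j ∉ tail δ P v) :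
    dropSet δ P v j = cov δ P v j := if_neg hj

theorem exists_mem_cov (hv : IsDrawingPath δ P v) {p : ℂ} (hp : p ∈ P) :
    ∃ j, p ∈ cov δ P v j := by
  obtain ⟨j, hj, hmax⟩ := Finset.exists_max_image
    (Finset.univ.filter fun j => dist p (v j) ≤ 1 - δ) id
    ((hv.near p hp).imp fun j hj => by simpa using hj)
  refine ⟨j, mem_cov.2 ⟨hp, (Finset.mem_filter.1 hj).2, fun j' hjj' h => ?_⟩⟩
  exact absurd (hmax j' (by simpa using h)) (not_le.2 hjj')

theorem mem_tail {s : Fin k} : s ∈ tail δ P v ↔ ∑ j ∈ Finset.Ici s, (cov δ P v j).card < 4 := by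
  simp [tail]

theorem mem_tail_of_le {s t : Fin k} (hs : s ∈ tail δ P v) (hst : s ≤ t) : t ∈ tail δ P v := by
  rw [mem_tail] at hs ⊢
  exact (Finset.sum_le_sum_of_subset (Finset.Ici_subset_Ici.2 hst)).trans_lt hs

/-- The coordinates at which a robot has been dropped on arrival at `v i`. -/
def dropped (δ : ℝ) (P : Finset ℂ) (v : Fin k → ℂ) (i : Fin k) : Finset ℂ :=
  (Finset.Iio i).biUnion (dropSet δ P v)

theorem mem_dropped {i : Fin k} {p : ℂ} :
    p ∈ dropped δ P v i ↔ ∃ j < i, p ∈ dropSet δ P v j := by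
  simp [dropped]

theorem dropped_subset (i : Fin k) : dropped δ P v i ⊆ P :=
  Finset.biUnion_subset.2 fun j _ => (dropSet_subset_cov j).trans (cov_subset j)

theorem remaining_eq (i : Fin k) : remaining δ P v i = (P \ dropped δ P v i).card := rfl

theorem remaining_le (i : Fin k) : remaining δ P v i ≤ P.card :=
  Finset.card_le_card Finset.sdiff_subset

/-- A coordinate is covered by the last vertex near it, so every later vertex is far away. This
keeps dropped robots clear of the formation. -/
theorem dist_of_mem_dropped {i : Fin k} {p : ℂ} (hp : p ∈ dropped δ P v i) :
    1 - δ < dist p (v i) := by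
  obtain ⟨j, hj, hp⟩ := mem_dropped.1 hp
  exact not_le.1 ((mem_cov.1 (dropSet_subset_cov j hp)).2.2 i hj)

theorem disjoint_dropSet_dropped (i : Fin k) : Disjoint (dropSet δ P v i) (dropped δ P v i) := by
  refine Finset.disjoint_left.2 fun p hp hp' => ?_
  obtain ⟨j, hj, hp'⟩ := mem_dropped.1 hp'
  exact hj.ne (eq_of_mem_cov (dropSet_subset_cov j hp') (dropSet_subset_cov i hp))

theorem dropped_succ {i j : Fin k} (hij : (j : ℕ) = i + 1) :
    dropped δ P v j = dropped δ P v i ∪ dropSet δ P v i := by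
  ext p
  simp only [mem_dropped, Finset.mem_union]
  constructor
  · rintro ⟨l, hl, hp⟩
    rcases (show (l : ℕ) < i ∨ (l : ℕ) = i by have := Fin.lt_def.1 hl; omega) with h | h
    · exact Or.inl ⟨l, h, hp⟩
    · exact Or.inr (Fin.ext h ▸ hp)
  · rintro (⟨l, hl, hp⟩ | hp)
    · exact ⟨l, Fin.lt_def.2 (by have := Fin.lt_def.1 hl; omega), hp⟩
    · exact ⟨i, Fin.lt_def.2 (by omega), hp⟩

theorem remaining_succ {i j : Fin k} (hij : (j : ℕ) = i + 1) :
    remaining δ P v j + (dropSet δ P v i).card = remaining δ P v i := by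
  rw [remaining_eq, remaining_eq, dropped_succ hij, ← Finset.sup_eq_union, ← sdiff_sdiff]
  exact Finset.card_sdiff_add_card_eq_card (Finset.subset_sdiff.2
    ⟨(dropSet_subset_cov i).trans (cov_subset i), disjoint_dropSet_dropped i⟩)

theorem dropped_mono {i j : Fin k} (hij : i ≤ j) : dropped δ P v i ⊆ dropped δ P v j :=
  Finset.biUnion_subset_biUnion_of_subset_left _ (Finset.Iio_subset_Iio hij)

theorem counter_lt {i j : Fin k} (hij : i < j)
    (h : ∀ l, i ≤ l → l < j → dropSet δ P v l = ∅) :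
    counter δ P v i < counter δ P v j := by
  refine Nat.add_lt_add_right (Finset.card_lt_card ?_) 1
  rw [Finset.ssubset_iff_of_subset]
  · exact ⟨i, by simpa using ⟨hij, h⟩, by simp⟩
  · intro l hl
    simp only [Finset.mem_filter, Finset.mem_univ, true_and] at hl ⊢
    refine ⟨hl.1.trans hij, fun m hlm hmj => ?_⟩
    rcases lt_or_ge m i with hm | hm
    · exact hl.2 m hlm hm
    · exact h m hm hmj

/-- The states encode the progress along the path. -/
theorem injective_remaining_counter :
    Function.Injective fun i : Fin k => (remaining δ P v i, counter δ P v i) := by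
  have key : ∀ i j : Fin k, i < j → remaining δ P v i = remaining δ P v j →
      counter δ P v i < counter δ P v j := by
    intro i j hij hr
    refine counter_lt hij fun l hil hlj => ?_
    -- The undropped sets are nested and of equal size, hence equal; a drop in between would
    -- separate them.
    have heq : P \ dropped δ P v j = P \ dropped δ P v i :=
      Finset.eq_of_subset_of_card_le (Finset.sdiff_subset_sdiff subset_rfl
        (dropped_mono hij.le)) hr.le
    refine Finset.eq_empty_of_forall_notMem fun p hp => ?_
    have hpP : p ∈ P := cov_subset l (dropSet_subset_cov l hp)
    have hpi : p ∉ dropped δ P v i := fun h => by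
      obtain ⟨m, hm, hpm⟩ := mem_dropped.1 h
      have := eq_of_mem_cov (dropSet_subset_cov m hpm) (dropSet_subset_cov l hp)
      exact absurd (this ▸ hm) (not_lt.2 hil)
    have := heq ▸ Finset.mem_sdiff.2 ⟨hpP, hpi⟩
    exact (Finset.mem_sdiff.1 this).2 (mem_dropped.2 ⟨l, hlj, hp⟩)
  intro i j hij
  have h := Prod.mk.inj hij
  rcases lt_trichotomy i j with hlt | heq | hlt
  · exact absurd h.2 (key i j hlt h.1).ne
  · exact heq
  · exact absurd h.2 (key j i hlt h.1.symm).ne'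

theorem remaining_zero [NeZero k] : remaining δ P v 0 = P.card := by
  rw [remaining_eq, show dropped δ P v 0 = ∅ from Finset.eq_empty_of_forall_notMem fun p hp => by
    obtain ⟨j, hj, -⟩ := mem_dropped.1 hp
    exact Fin.not_lt_zero j hj, Finset.sdiff_empty]

theorem counter_zero [NeZero k] : counter δ P v 0 = 1 := by
  simp [counter]

/-- On arrival in the tail everything covered before it has been dropped, and nothing is dropped
inside it. -/
theorem remaining_of_mem_tail (hv : IsDrawingPath δ P v) {i : Fin k} (hi : i ∈ tail δ P v) :
    remaining δ P v i = (covTail δ P v).card := by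
  rw [remaining_eq]
  congr 1
  ext p
  simp only [Finset.mem_sdiff, covTail, Finset.mem_biUnion]
  constructor
  · rintro ⟨hp, hpd⟩
    obtain ⟨j, hj⟩ := exists_mem_cov hv hp
    refine ⟨j, ?_, hj⟩
    by_contra hjt
    refine hpd (mem_dropped.2 ⟨j, ?_, dropSet_of_notMem_tail hjt ▸ hj⟩)
    exact not_le.1 fun h => hjt (mem_tail_of_le hi h)
  · rintro ⟨j, hjt, hj⟩
    refine ⟨cov_subset j hj, fun h => ?_⟩
    obtain ⟨l, -, hl⟩ := mem_dropped.1 h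
    obtain rfl := eq_of_mem_cov (dropSet_subset_cov l hl) hj
    simp [dropSet, hjt] at hl

/-- Outside the tail the suffix from `i` covers at least four coordinates, all still undropped. -/
theorem four_le_remaining {i : Fin k} (hi : i ∉ tail δ P v) : 4 ≤ remaining δ P v i := by
  rw [mem_tail, not_lt, ← Finset.card_biUnion fun _ _ _ _ h => pairwiseDisjoint_cov Set.univ
    (Set.mem_univ _) (Set.mem_univ _) h] at hi
  refine hi.trans (Finset.card_le_card fun p hp => ?_)
  obtain ⟨j, hj, hpj⟩ := Finset.mem_biUnion.1 hp
  refine Finset.mem_sdiff.2 ⟨cov_subset j hpj, fun h => ?_⟩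
  obtain ⟨l, hl, hpl⟩ := mem_dropped.1 h
  obtain rfl := eq_of_mem_cov (dropSet_subset_cov l hpl) hpj
  exact absurd hl (not_lt.2 (Finset.mem_Ici.1 hj))

/-- If the tail covers fewer than four coordinates, vertices before a tail vertex that are left
without a drop up to there belong to the tail. -/
theorem mem_tail_of_dropSet_eq_empty (hc : (covTail δ P v).card < 4) {i j : Fin k}
    (hi : i ∈ tail δ P v) (h : ∀ l, j ≤ l → l < i → dropSet δ P v l = ∅) : j ∈ tail δ P v := by
  rw [mem_tail]
  refine lt_of_le_of_lt ?_ hc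
  rw [← Finset.card_biUnion fun _ _ _ _ h => pairwiseDisjoint_cov Set.univ
    (Set.mem_univ _) (Set.mem_univ _) h]
  refine Finset.card_le_card fun p hp => ?_
  obtain ⟨l, hl, hpl⟩ := Finset.mem_biUnion.1 hp
  refine Finset.mem_biUnion.2 ⟨l, ?_, hpl⟩
  by_contra hlt
  have := h l (Finset.mem_Ici.1 hl) (not_le.1 fun hil => hlt (mem_tail_of_le hi hil))
  rw [dropSet_of_notMem_tail hlt] at this
  simp [this] at hpl

theorem counter_le_card_tail (hc : (covTail δ P v).card < 4) {i : Fin k}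
    (hi : i ∈ tail δ P v) : counter δ P v i ≤ (tail δ P v).card := by
  rw [counter, Nat.add_one_le_iff]
  refine Finset.card_lt_card ((Finset.ssubset_iff_of_subset fun j hj => ?_).2 ⟨i, hi, by simp⟩)
  exact mem_tail_of_dropSet_eq_empty hc hi (Finset.mem_filter.1 hj).2.2

/-- The counter is either 1, or bounded by the length of a path without drops. -/
theorem counter_le {i : Fin k} (hi : i ∉ tail δ P v) {m : ℕ} (hm : 1 ≤ m)
    (hbody : ∀ s t : Fin k, s < t → (∀ j, s ≤ j → j < t → cov δ P v j = ∅) →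
      (t : ℕ) - (s : ℕ) + 1 ≤ m) : counter δ P v i ≤ m := by
  rw [counter]
  set J : Finset (Fin k) := {j | j < i ∧ ∀ l, j ≤ l → l < i → dropSet δ P v l = ∅} with hJ
  rcases J.eq_empty_or_nonempty with h | h
  · simpa [h] using hm
  · obtain ⟨hs, hs'⟩ : J.min' h < i ∧ ∀ l, J.min' h ≤ l → l < i → dropSet δ P v l = ∅ := by
      simpa [hJ] using J.min'_mem h
    -- The drop-free run from the first element of `J` up to `i` lies before the tail, so its
    -- vertices cover nothing and the bound on the body applies.
    have hsub : J ⊆ Finset.Ico (J.min' h) i := fun j hj =>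
      Finset.mem_Ico.2 ⟨J.min'_le j hj, (Finset.mem_filter.1 hj).2.1⟩
    have hcard := Finset.card_le_card hsub
    rw [Fin.card_Ico] at hcard
    refine (Nat.add_le_add_right hcard 1).trans (hbody _ i hs fun j hj hji => ?_)
    rw [← dropSet_of_notMem_tail fun hjt => hi (mem_tail_of_le hjt hji.le)]
    exact hs' j hj hji

end Path

/-! ### From recognition to a protocol -/

section Protocols

/-- What a robot at `x` sees if `C` is the set of all positions. -/
def viewOf (C : Set ℂ) (x : ℂ) (u : Circle) : Set ℂ :=
  {w | ∃ y ∈ C, dist y x ≤ 1 ∧ w = (u : ℂ) * (y - x)}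

theorem view_eq {ι : Type*} (pos : ι → ℂ) (r : ι) (u : Circle) :
    view pos r u = viewOf (Set.range pos) (pos r) u := by
  ext w
  simp [view, viewOf]

theorem mem_viewOf_iff {C : Set ℂ} {x : ℂ} {u : Circle} {y : ℂ} :
    (u : ℂ) * (y - x) ∈ viewOf C x u ↔ y ∈ C ∧ dist y x ≤ 1 := by
  constructor
  · rintro ⟨z, hz, hd, h⟩
    have := sub_left_injective (mul_left_cancel₀ u.coe_ne_zero h)
    exact this ▸ ⟨hz, hd⟩
  · rintro ⟨hy, hd⟩
    exact ⟨y, hy, hd, rfl⟩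

/-- If robots at the points of `S i` recognize from their view in which configuration `C i` and at
which point they are, then there is a protocol that moves them as prescribed by `g i`. -/
theorem exists_protocol {κ : Type*} (C S : κ → Set ℂ) (g : κ → ℂ → ℂ)
    (hg : ∀ i, ∀ x ∈ S i, ‖g i x - x‖ ≤ 1)
    (hrec : ∀ i i' x x' u u', x ∈ S i → x' ∈ C i' → viewOf (C i) x u = viewOf (C i') x' u' →
      i = i' ∧ x = x' ∧ u = u') :
    ∃ A : Protocol, ∀ {ι : Type} (pos : ι → ℂ) (u : ι → Circle) (i : κ) (r : ι),
      S i ⊆ C i → Set.range pos = C i →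
      lcmCycle A pos u r = if pos r ∈ S i then g i (pos r) else pos r := by
  let Q : Set ℂ → κ × ℂ × Circle → Prop := fun V z =>
    z.2.1 ∈ S z.1 ∧ V = viewOf (C z.1) z.2.1 z.2.2
  -- Decode the view by an arbitrary choice of (configuration, position, frame) and perform the
  -- prescribed move in that frame; stay put if no decoding exists.
  refine ⟨⟨fun V => if h : ∃ z, Q V z then
    (h.choose.2.2 : ℂ) * (g h.choose.1 h.choose.2.1 - h.choose.2.1) else 0, fun V => ?_⟩, ?_⟩
  · split_ifs with h
    · rw [norm_mul, Circle.norm_coe, one_mul]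
      exact hg _ _ h.choose_spec.1
    · simp
  · intro ι pos u i r hSC hC
    have hr : pos r ∈ C i := hC ▸ Set.mem_range_self r
    simp only [lcmCycle, view_eq, hC]
    by_cases h : ∃ z, Q (viewOf (C i) (pos r) (u r)) z
    · rw [dif_pos h]
      -- Uniqueness of the decoding makes the choice the true one. It also rules out that a robot
      -- outside `S i` is taken for a member of some `S i'`.
      obtain ⟨h1, h2, h3⟩ := hrec _ _ _ _ _ _ h.choose_spec.1 hr h.choose_spec.2.symm
      have h4 := h.choose_spec.1
      rw [h1, h2] at h4
      rw [h1, h2, h3, if_pos h4, ← mul_assoc, ← Circle.coe_mul, inv_mul_cancel, Circle.coe_one,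
        one_mul, add_sub_cancel]
    · rw [dif_neg h, mul_zero, add_zero, if_neg fun hS => h ⟨(i, pos r, u r), hS, rfl⟩]

end Protocols

/-! ### Recognizing frame, position and state from a view -/

section Recognition

variable {ε : ℝ} {H H' : DrawingHull} {C C' : Set ℂ}

/-- In the configuration `C`, the formation with hull `H` is granular, and other robots keep
distance more than `ε` to it and to each other. -/
structure IsSeparated (ε : ℝ) (H : DrawingHull) (C : Set ℂ) : Prop where
  granular : C ∩ H.region ∈ granularStates ε H
  outer : ∀ x ∈ C, x ∉ H.region → H.diam + ε < dist x H.anchor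
  sep : ∀ x ∈ C, x ∉ H.region → ∀ y ∈ C, y ∉ H.region → x ≠ y → ε < dist x y

/-- An outer robot is further than `Δ + ε` from the anchor, hence further than `ε` from every point
of the hull; the pair at distance `ε` must then consist of state robots. -/
theorem IsSeparated.eq_of_dist_eq (h : IsSeparated ε H C) (hε : 0 < ε) {x y : ℂ}
    (hx : x ∈ C) (hy : y ∈ C) (hxy : dist x y = ε) :
    (x = H.anchor ∧ y = H.anchor + (ε : ℂ) * H.dir) ∨
      (y = H.anchor ∧ x = H.anchor + (ε : ℂ) * H.dir) := by
  have hL := ((mem_granularStates_iff hε _).1 h.granular).1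
  have mixed : ∀ x ∈ C, ∀ y, x ∉ H.region → y ∈ H.region → ε < dist x y := by
    intro x hx y hxr hyr
    have h1 := h.outer x hx hxr
    have h2 := H.dist_anchor_le hyr
    have h3 := dist_triangle x y H.anchor
    linarith
  by_cases hxr : x ∈ H.region <;> by_cases hyr : y ∈ H.region
  · exact Drawing.eq_of_dist_eq hε (hL ⟨hx, hxr⟩) (hL ⟨hy, hyr⟩) hxy
  · exact absurd (dist_comm x y ▸ hxy) (mixed y hy x hyr hxr).ne'
  · exact absurd hxy (mixed x hx y hxr hyr).ne'
  · have hne : x ≠ y := fun h => by simp [h, hε.ne] at hxy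
    exact absurd hxy (h.sep x hx hxr y hy hyr hne).ne'

/-- The view of a state robot determines the orientation of its coordinate system, its position
relative to the hull, and the state. -/
theorem IsSeparated.recognize (h : IsSeparated ε H C) (h' : IsSeparated ε H' C') (hε : 0 < ε)
    (hdir : H'.dir = H.dir) (hdiam : H'.diam = H.diam)
    (hreg : ∀ x, x ∈ H.region ↔ x + (H'.anchor - H.anchor) ∈ H'.region)
    {x x' : ℂ} {u u' : Circle} (hx : x ∈ C ∩ H.region)
    (hV : viewOf C x u = viewOf C' x' u') :
    u = u' ∧ x' - H'.anchor = x - H.anchor ∧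
      C' ∩ H'.region = (fun y => y + (H'.anchor - H.anchor)) '' (C ∩ H.region) := by
  obtain ⟨hL, ha, hb, t, ⟨m, hm, hmd, rfl⟩, ht⟩ := (mem_granularStates_iff hε _).1 h.granular
  have hnear : ∀ y ∈ H.region, dist y x ≤ 1 := fun y hy =>
    (H.dist_le_of_mem_region hy hx.2).trans H.diam_le
  have hu' : (u' : ℂ) ≠ 0 := u'.coe_ne_zero
  -- Equal views mean that the rigid motion `y ↦ x' + ω (y - x)` matches what is visible in `C` with
  -- what is visible in `C'`. It carries the `ε`-pair to the `ε`-pair, preserving or swapping its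
  -- ends, so `ω = 1` or `ω = -1`.
  set ω : ℂ := (u : ℂ) / u' with hω
  have hω1 : ‖ω‖ = 1 := by
    rw [hω, norm_div, Circle.norm_coe, Circle.norm_coe, div_one]
  have hψ : ∀ y, (u : ℂ) * (y - x) = u' * ((x' + ω * (y - x)) - x') := by
    intro y
    rw [hω, add_sub_cancel_left, ← mul_assoc, mul_div_cancel₀ _ hu']
  have hmem : ∀ y, (y ∈ C ∧ dist y x ≤ 1) ↔
      (x' + ω * (y - x) ∈ C' ∧ dist (x' + ω * (y - x)) x' ≤ 1) := by
    intro y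
    rw [← mem_viewOf_iff (u := u), hV, hψ, mem_viewOf_iff]
  have hfwd : ∀ y ∈ C ∩ H.region, x' + ω * (y - x) ∈ C' := fun y hy =>
    ((hmem y).1 ⟨hy.1, hnear y hy.2⟩).1
  have hεd : (ε : ℂ) * H.dir ≠ 0 := mul_ne_zero (by exact_mod_cast hε.ne') H.dir_ne_zero
  have hdist : dist (x' + ω * (H.anchor - x))
      (x' + ω * (H.anchor + (ε : ℂ) * H.dir - x)) = ε := by
    rw [dist_comm, dist_eq_norm, show x' + ω * (H.anchor + (ε : ℂ) * H.dir - x) -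
      (x' + ω * (H.anchor - x)) = ω * ((ε : ℂ) * H.dir) by ring, norm_mul, hω1, norm_mul,
      H.norm_dir, Complex.norm_real, Real.norm_eq_abs, abs_of_pos hε, one_mul, mul_one]
  rcases h'.eq_of_dist_eq hε (hfwd _ ha) (hfwd _ hb) hdist with ⟨h1, h2⟩ | ⟨h1, h2⟩
  · have hone : ω = 1 := by
      rw [hdir] at h2
      refine mul_right_cancel₀ hεd ?_
      linear_combination h2 - h1
    rw [hone] at h1 hmem
    refine ⟨?_, by linear_combination h1, ?_⟩
    · refine Circle.ext ?_
      rwa [hω, div_eq_one_iff_eq hu'] at hone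
    · have hshift : ∀ y, x' + 1 * (y - x) = y + (H'.anchor - H.anchor) := fun y => by
        linear_combination h1
      -- Since `x'` lies in its hull too, it sees the entire state there, so the correspondence of
      -- states is onto.
      have hx'r : x' ∈ H'.region := by
        have := (hreg x).1 hx.2
        rwa [← hshift, sub_self, mul_zero, add_zero] at this
      ext y
      constructor
      · rintro ⟨hy, hyr⟩
        have hy' : y = (y - (H'.anchor - H.anchor)) + (H'.anchor - H.anchor) := by ring
        refine ⟨y - (H'.anchor - H.anchor), ⟨?_, ?_⟩, hy'.symm⟩
        · refine ((hmem _).2 ?_).1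
          rw [hshift, ← hy']
          exact ⟨hy, (H'.dist_le_of_mem_region hyr hx'r).trans H'.diam_le⟩
        · rw [hreg, ← hy']
          exact hyr
      · rintro ⟨z, hz, rfl⟩
        refine ⟨?_, (hreg z).1 hz.2⟩
        have := ((hmem z).1 ⟨hz.1, hnear z hz.2⟩).1
        rwa [hshift] at this
  · exfalso
    have hone : ω = -1 := by
      rw [hdir] at h2
      refine mul_right_cancel₀ hεd ?_
      linear_combination h1 - h2
    have htC := hfwd _ ht
    -- In the swapped case the third defining robot lands behind the anchor: outside the hull, yet
    -- at distance `2mε < Δ`, where no outer robot can be.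
    have heq : x' + ω * (H.anchor + ((1 + 2 * m : ℝ) * ε : ℝ) * H.dir - x) =
        H'.anchor - ((2 * m * ε : ℝ) : ℂ) * H.dir := by
      rw [hdir] at h2
      rw [hone] at h2 ⊢
      push_cast
      linear_combination h2
    rw [heq] at htC
    have hm1 : (1 : ℝ) ≤ m := by exact_mod_cast hm
    by_cases hr : H'.anchor - ((2 * m * ε : ℝ) : ℂ) * H.dir ∈ H'.region
    · have := H'.re_div_dir_nonneg hr
      rw [sub_sub_cancel_left, hdir, neg_div, mul_div_cancel_right₀ _ H.dir_ne_zero,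
        Complex.neg_re, Complex.ofReal_re] at this
      nlinarith
    · have := h'.outer _ htC hr
      rw [dist_eq_norm, sub_sub_cancel_left, norm_neg, norm_mul, H.norm_dir, mul_one,
        Complex.norm_real, Real.norm_eq_abs, abs_of_nonneg (by positivity), hdiam] at this
      nlinarith

end Recognition

/-! ### Traversal of the path and its invariant -/

section Traversal

variable {k : ℕ} {ε δ : ℝ} {P : Finset ℂ} {v : Fin k → ℂ}
  {e : DrawingHull → ℕ → ℕ → Set ℂ} {H : DrawingHull}

/-- The state of the formation at the vertex `v i`. -/
def stateAt (δ : ℝ) (P : Finset ℂ) (v : Fin k → ℂ) (e : DrawingHull → ℕ → ℕ → Set ℂ)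
    (H : DrawingHull) (i : Fin k) : Set ℂ :=
  e (H.moveTo (v i)) (remaining δ P v i) (counter δ P v i)

/-- The set of all robot positions when the formation is at the vertex `v i`. -/
def configAt (δ : ℝ) (P : Finset ℂ) (v : Fin k → ℂ) (e : DrawingHull → ℕ → ℕ → Set ℂ)
    (H : DrawingHull) (i : Fin k) : Set ℂ :=
  stateAt δ P v e H i ∪ dropped δ P v i

/-- The conditions under which the formation with hull `H` can traverse `v`. -/
structure IsTraversable (ε δ : ℝ) (P : Finset ℂ) (v : Fin k → ℂ)
    (e : DrawingHull → ℕ → ℕ → Set ℂ) (H : DrawingHull) : Prop where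
  pos : 0 < ε
  enum : IsStateEnumeration ε e
  path : IsDrawingPath δ P v
  diam_add_le : H.diam + ε ≤ 1 - δ
  diam_le : H.diam ≤ δ
  mindist : ∀ p ∈ P, ∀ q ∈ P, p ≠ q → ε < dist p q
  counter_mem : ∀ i, counter δ P v i ∈
    Set.Icc 1 (granularStatesOfSize ε (H.moveTo (v i)) (remaining δ P v i)).ncard
  remaining_pos : ∀ i, 0 < remaining δ P v i

namespace IsTraversable

variable (h : IsTraversable ε δ P v e H)
include h

theorem stateAt_mem (i : Fin k) : stateAt δ P v e H i ∈
    granularStatesOfSize ε (H.moveTo (v i)) (remaining δ P v i) :=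
  (h.enum.bijOn _ _).mapsTo (h.counter_mem i)

theorem stateAt_subset (i : Fin k) : stateAt δ P v e H i ⊆ (H.moveTo (v i)).region :=
  ((mem_granularStates_iff h.pos _).1 (h.stateAt_mem i).1).1.trans granularLocations_subset_region

theorem ncard_stateAt (i : Fin k) : (stateAt δ P v e H i).ncard = remaining δ P v i :=
  (h.stateAt_mem i).2

theorem finite_stateAt (i : Fin k) : (stateAt δ P v e H i).Finite :=
  Set.finite_of_ncard_pos (by rw [h.ncard_stateAt]; exact h.remaining_pos i)

theorem diam_add_lt_dist {i : Fin k} {p : ℂ} (hp : 1 - δ < dist p (v i)) :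
    H.diam + ε < dist p (v i) := h.diam_add_le.trans_lt hp

theorem notMem_region {i : Fin k} {p : ℂ} (hp : 1 - δ < dist p (v i)) :
    p ∉ (H.moveTo (v i)).region := fun hr => by
  have h1 : dist p (v i) ≤ H.diam := (H.moveTo (v i)).dist_anchor_le hr
  have h2 := h.diam_add_lt_dist hp
  linarith [h.pos]

theorem configAt_inter (i : Fin k) :
    configAt δ P v e H i ∩ (H.moveTo (v i)).region = stateAt δ P v e H i := by
  ext x
  constructor
  · rintro ⟨hx | hx, hr⟩
    · exact hx
    · exact absurd hr (h.notMem_region (dist_of_mem_dropped hx))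
  · exact fun hx => ⟨Or.inl hx, h.stateAt_subset i hx⟩

theorem mem_dropped_of_notMem {i : Fin k} {x : ℂ} (hx : x ∈ configAt δ P v e H i)
    (hr : x ∉ (H.moveTo (v i)).region) : x ∈ dropped δ P v i :=
  hx.resolve_left fun hs => hr (h.stateAt_subset i hs)

theorem isSeparated (i : Fin k) :
    IsSeparated ε (H.moveTo (v i)) (configAt δ P v e H i) where
  granular := by
    rw [h.configAt_inter]
    exact (h.stateAt_mem i).1
  outer x hx hr := h.diam_add_lt_dist (dist_of_mem_dropped (h.mem_dropped_of_notMem hx hr))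
  sep x hx hxr y hy hyr hxy := h.mindist x (dropped_subset i (h.mem_dropped_of_notMem hx hxr)) y
    (dropped_subset i (h.mem_dropped_of_notMem hy hyr)) hxy

/-- The two states are translates of each other, so they have equal size and, as the enumeration is
translation invariant and injective, equal index. The pair then determines the vertex. -/
theorem recognize {i i' : Fin k} {x x' : ℂ} {u u' : Circle} (hx : x ∈ stateAt δ P v e H i)
    (hV : viewOf (configAt δ P v e H i) x u = viewOf (configAt δ P v e H i') x' u') :
    i = i' ∧ x = x' ∧ u = u' := by
  have hreg : ∀ y, y ∈ (H.moveTo (v i)).region ↔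
      y + ((H.moveTo (v i')).anchor - (H.moveTo (v i)).anchor) ∈ (H.moveTo (v i')).region := by
    intro y
    rw [H.mem_region_moveTo, H.mem_region_moveTo]
    simp only [DrawingHull.moveTo]
    rw [show y + (v i' - v i) + (H.anchor - v i') = y + (H.anchor - v i) by ring]
  obtain ⟨hu, hxx, hS⟩ := (h.isSeparated i).recognize (h.isSeparated i') h.pos rfl rfl hreg
    (by rwa [h.configAt_inter]) hV
  rw [h.configAt_inter, h.configAt_inter] at hS
  have hrem : remaining δ P v i' = remaining δ P v i := by
    rw [← h.ncard_stateAt, ← h.ncard_stateAt, hS,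
      Set.ncard_image_of_injective _ (add_left_injective _)]
  have hmem := h.counter_mem i
  have hrel := h.enum.relative (H.moveTo (v i)) (H.moveTo (v i')) rfl rfl _ _ hmem
  have hcount : counter δ P v i' = counter δ P v i := by
    refine (h.enum.bijOn (H.moveTo (v i')) (remaining δ P v i')).injOn (h.counter_mem i') ?_ ?_
    · rw [ncard_granularStatesOfSize_moveTo h.pos] at hmem ⊢
      rwa [hrem]
    · refine Eq.trans hS ?_
      rw [hrem, hrel]
      refine Set.image_congr fun y _ => ?_
      simp only [DrawingHull.moveTo, div_self H.dir_ne_zero]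
      ring
  obtain rfl : i = i' := injective_remaining_counter (Prod.ext hrem.symm hcount.symm)
  exact ⟨rfl, (sub_left_injective hxx).symm, hu⟩

theorem disjoint_stateAt_dropSet {i j : Fin k} (hij : (j : ℕ) = i + 1) :
    Disjoint (stateAt δ P v e H j) (dropSet δ P v i : Set ℂ) := by
  refine Set.disjoint_left.2 fun x hx hd => h.notMem_region ?_ (h.stateAt_subset j hx)
  refine dist_of_mem_dropped (P := P) ?_
  rw [dropped_succ hij]
  exact Finset.mem_union_right _ hd

/-- Any bijection serves, since source and target have equal cardinality. A target in the new state
costs one edge plus a displacement inside one hull; a drop target costs its distance to `v i` plus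
the distance from `v i` to the robot. Both are at most `(1 - δ) + Δ ≤ 1`. -/
theorem exists_step (i : Fin k) : ∃ g : ℂ → ℂ, (∀ x ∈ stateAt δ P v e H i, ‖g x - x‖ ≤ 1) ∧
    ∀ j : Fin k, (j : ℕ) = i + 1 →
      Set.BijOn g (stateAt δ P v e H i) (stateAt δ P v e H j ∪ dropSet δ P v i) := by
  by_cases hj : ∃ j : Fin k, (j : ℕ) = i + 1
  · obtain ⟨j, hij⟩ := hj
    have hcard : (stateAt δ P v e H i).ncard =
        (stateAt δ P v e H j ∪ dropSet δ P v i : Set ℂ).ncard := by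
      rw [Set.ncard_union_eq (h.disjoint_stateAt_dropSet hij) (h.finite_stateAt j)
        (Finset.finite_toSet _), h.ncard_stateAt, h.ncard_stateAt, Set.ncard_coe_finset,
        remaining_succ hij]
    obtain ⟨g, hg⟩ := (h.finite_stateAt i).exists_bijOn_of_encard_eq (t :=
      (stateAt δ P v e H j ∪ dropSet δ P v i : Set ℂ)) (by
        rw [← (h.finite_stateAt i).cast_ncard_eq, hcard,
          ((h.finite_stateAt j).union (Finset.finite_toSet _)).cast_ncard_eq])
    refine ⟨g, fun x hx => ?_, fun j' hj' => ?_⟩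
    · have hxr := h.stateAt_subset i hx
      rw [← dist_eq_norm]
      rcases hg.mapsTo hx with hgx | hgx
      · have hgr := h.stateAt_subset j hgx
        have hshift : g x + (v i - v j) ∈ (H.moveTo (v i)).region := by
          rw [H.mem_region_moveTo] at hgr ⊢
          rwa [show g x + (v i - v j) + (H.anchor - v i) = g x + (H.anchor - v j) by ring]
        have h1 : dist (g x + (v i - v j)) x ≤ H.diam :=
          (H.moveTo (v i)).dist_le_of_mem_region hshift hxr
        have h2 : dist (g x) (g x + (v i - v j)) = dist (v i) (v j) := by
          rw [dist_eq_norm, dist_eq_norm, ← norm_neg]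
          congr 1
          ring
        have h3 := h.path.edge i j hij
        have h4 := dist_triangle (g x) (g x + (v i - v j)) x
        linarith [h.diam_le]
      · have h1 : dist x (v i) ≤ H.diam := (H.moveTo (v i)).dist_anchor_le hxr
        have h2 := (mem_cov.1 (dropSet_subset_cov i hgx)).2.1
        have h3 := dist_triangle_right (g x) x (v i)
        linarith [h.diam_le]
    · obtain rfl : j' = j := Fin.ext (hj'.trans hij.symm)
      exact hg
  · exact ⟨id, by simp, fun j hij => absurd ⟨j, hij⟩ hj⟩

theorem exists_protocol_of_step : ∃ (A : Protocol) (g : Fin k → ℂ → ℂ),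
    (∀ i j : Fin k, (j : ℕ) = i + 1 →
      Set.BijOn (g i) (stateAt δ P v e H i) (stateAt δ P v e H j ∪ dropSet δ P v i)) ∧
    ∀ {ι : Type} (pos : ι → ℂ) (u : ι → Circle) (i : Fin k) (r : ι),
      Set.range pos = configAt δ P v e H i → lcmCycle A pos u r =
        if pos r ∈ stateAt δ P v e H i then g i (pos r) else pos r := by
  choose g hg1 hg2 using h.exists_step
  obtain ⟨A, hA⟩ := exists_protocol (configAt δ P v e H) (stateAt δ P v e H) g hg1
    fun i i' x x' u u' hx _ hV => h.recognize hx hV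
  exact ⟨A, g, hg2, fun pos u i r hpos => hA pos u i r Set.subset_union_left hpos⟩

section Step

variable {ι : Type*} {pos pos' : ι → ℂ} {i j : Fin k} {g : ℂ → ℂ}

theorem isInState (hinj : Function.Injective pos)
    (hrange : Set.range pos = configAt δ P v e H i) :
    IsInState ε e pos (H.moveTo (v i)) (remaining δ P v i) (counter δ P v i) := by
  have hst : formationState pos (H.moveTo (v i)) = stateAt δ P v e H i := by
    rw [← h.configAt_inter, ← hrange, Set.inter_comm]
    exact Set.image_preimage_eq_inter_range
  refine ⟨?_, h.counter_mem i, hst⟩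
  rw [← h.ncard_stateAt, ← hst, formationState, Set.ncard_image_of_injective _ hinj]

theorem mem_stateRobots_iff (hrange : Set.range pos = configAt δ P v e H i) (r : ι) :
    r ∈ stateRobots pos (H.moveTo (v i)) ↔ pos r ∈ stateAt δ P v e H i := by
  rw [← h.configAt_inter, ← hrange]
  exact ⟨fun hr => ⟨Set.mem_range_self r, hr⟩, fun hr => hr.2⟩

variable (hij : (j : ℕ) = i + 1)
  (hpos' : ∀ r, pos' r = if pos r ∈ stateAt δ P v e H i then g (pos r) else pos r)
  (hrange : Set.range pos = configAt δ P v e H i)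
include hij hpos' hrange

/-- A standing robot occupies an earlier drop coordinate, which is far from `v j` and distinct from
the new drops. So it neither collides with a moving robot nor joins the formation. -/
theorem moves_notMem_state {r : ι} (hr : pos r ∉ stateAt δ P v e H i) :
    pos' r ∉ stateAt δ P v e H j ∪ dropSet δ P v i := by
  rw [hpos', if_neg hr]
  have hd : pos r ∈ dropped δ P v i :=
    (hrange ▸ Set.mem_range_self r : pos r ∈ configAt δ P v e H i).resolve_left hr
  rintro (hs | hs)
  · refine h.notMem_region (dist_of_mem_dropped (P := P) ?_) (h.stateAt_subset j hs)
    rw [dropped_succ hij]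
    exact Finset.mem_union_left _ hd
  · exact Finset.disjoint_left.1 (disjoint_dropSet_dropped i) hs hd

variable (hg : Set.BijOn g (stateAt δ P v e H i) (stateAt δ P v e H j ∪ dropSet δ P v i))
include hg

theorem range_step : Set.range pos' = configAt δ P v e H j := by
  have hU : configAt δ P v e H j =
      (stateAt δ P v e H j ∪ dropSet δ P v i) ∪ dropped δ P v i := by
    rw [configAt, dropped_succ hij, Finset.coe_union, Set.union_comm (dropped δ P v i : Set ℂ),
      Set.union_assoc]
  rw [hU]
  ext y
  constructor
  · rintro ⟨r, rfl⟩
    rw [hpos']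
    have hr : pos r ∈ configAt δ P v e H i := hrange ▸ Set.mem_range_self r
    split_ifs with hs
    · exact Or.inl (hg.mapsTo hs)
    · exact Or.inr (hr.resolve_left hs)
  · rintro (hy | hy)
    · obtain ⟨x, hx, rfl⟩ := hg.surjOn hy
      obtain ⟨r, rfl⟩ : x ∈ Set.range pos := hrange ▸ Or.inl hx
      exact ⟨r, by rw [hpos', if_pos hx]⟩
    · obtain ⟨r, rfl⟩ : y ∈ Set.range pos := hrange ▸ Or.inr hy
      have hr : pos r ∉ stateAt δ P v e H i := fun hs =>
        h.notMem_region (dist_of_mem_dropped hy) (h.stateAt_subset i hs)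
      exact ⟨r, by rw [hpos', if_neg hr]⟩

theorem injective_step (hinj : Function.Injective pos) : Function.Injective pos' := by
  intro r s hrs
  by_cases hr : pos r ∈ stateAt δ P v e H i <;> by_cases hs : pos s ∈ stateAt δ P v e H i
  · rw [hpos', hpos', if_pos hr, if_pos hs] at hrs
    exact hinj (hg.injOn hr hs hrs)
  · refine absurd ?_ (h.moves_notMem_state hij hpos' hrange hs)
    rw [← hrs, hpos', if_pos hr]
    exact hg.mapsTo hr
  · refine absurd ?_ (h.moves_notMem_state hij hpos' hrange hr)
    rw [hrs, hpos', if_pos hs]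
    exact hg.mapsTo hs
  · rw [hpos', hpos', if_neg hr, if_neg hs] at hrs
    exact hinj hrs

theorem formation_step (hinj : Function.Injective pos) :
    FormationMoves pos pos' (H.moveTo (v i)) (v j) ∧
      Set.BijOn pos' (stateRobots pos (H.moveTo (v i)) \ stateRobots pos' (H.moveTo (v j)))
        (dropSet δ P v i) ∧
      ∀ r, r ∉ stateRobots pos (H.moveTo (v i)) → pos' r = pos r := by
  have hrange' := h.range_step hij hpos' hrange hg
  have hiff := h.mem_stateRobots_iff hrange
  have hiff' := h.mem_stateRobots_iff hrange'
  refine ⟨fun r hr => ?_, ⟨?_, (h.injective_step hij hpos' hrange hg hinj).injOn, ?_⟩, ?_⟩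
  · have hr' := (hiff' r).1 hr
    rw [hiff]
    by_contra hs
    exact h.moves_notMem_state hij hpos' hrange hs (Or.inl hr')
  · rintro r ⟨hr, hr'⟩
    rw [hiff] at hr
    rw [hiff'] at hr'
    have := hg.mapsTo hr
    rw [hpos', if_pos hr] at hr' ⊢
    exact this.resolve_left hr'
  · intro y hy
    obtain ⟨x, hx, rfl⟩ := hg.surjOn (Or.inr hy)
    obtain ⟨r, rfl⟩ : x ∈ Set.range pos := hrange ▸ Or.inl hx
    have hpr : pos' r = g (pos r) := by rw [hpos', if_pos hx]
    refine ⟨r, ⟨(hiff r).2 hx, fun hr' => ?_⟩, hpr⟩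
    rw [hiff', hpr] at hr'
    exact Set.disjoint_left.1 (h.disjoint_stateAt_dropSet hij) hr' hy
  · intro r hr
    rw [hiff] at hr
    rw [hpos', if_neg hr]

end Step

end IsTraversable

/-- The substance is that each counter is a valid index: in the tail by comparison with the number
of states of size 3, before it with that of size 4, which is at most the number for the current
size. -/
theorem isTraversable_of_compatible [NeZero k] {ι : Type*} {pos : ι → ℂ} (hε : 0 < ε)
    (he : IsStateEnumeration ε e) (hv : IsDrawingPath δ P v)
    (hdiam : H.diam + ε ≤ 1 - δ) (hloc : P.card + 2 ≤ (granularLocations ε H).ncard)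
    (hc : Compatible ε δ P v pos H) (hs : IsInState ε e pos H P.card 1) :
    IsTraversable ε δ P v e H := by
  have hthree : ∀ i, 3 ≤ remaining δ P v i := fun i => by
    by_cases hi : i ∈ tail δ P v
    · rw [remaining_of_mem_tail hv hi, hc.tail_card]
    · exact le_trans (by norm_num) (four_le_remaining hi)
  have hL : (granularLocations ε H).Finite := Set.finite_of_ncard_pos (by omega)
  have hne : (granularStatesOfSize ε H P.card).Nonempty :=
    ⟨_, (he.bijOn H P.card).mapsTo hs.2.1⟩
  have htail : (covTail δ P v).card < 4 := by rw [hc.tail_card]; norm_num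
  refine ⟨hε, he, hv, hdiam, hc.diam_le, hc.mindist, fun i => ⟨Nat.le_add_left _ _, ?_⟩,
    fun i => lt_of_lt_of_le (by norm_num) (hthree i)⟩
  rw [ncard_granularStatesOfSize_moveTo hε]
  by_cases hi : i ∈ tail δ P v
  · rw [remaining_of_mem_tail hv hi, hc.tail_card]
    exact (counter_le_card_tail htail hi).trans hc.tail_length
  · have h4 := four_le_remaining hi
    have hle := remaining_le (δ := δ) (P := P) (v := v) i
    refine (counter_le hi ?_ hc.body).trans
      (ncard_granularStatesOfSize_four_le hε h4 (by omega))
    exact ncard_granularStatesOfSize_pos hε hL (by norm_num) (h4.trans hle) hne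

/-- All robots are state robots, and the state has as many positions as there are robots; hence no
two coincide. -/
theorem initial_configuration [NeZero k] {pos : Fin P.card → ℂ} (h : IsTraversable ε δ P v e H)
    (hanchor : H.anchor = v 0) (hs : IsInState ε e pos H P.card 1) :
    Function.Injective pos ∧ Set.range pos = configAt δ P v e H 0 := by
  have hH : H.moveTo (v 0) = H := by rw [← hanchor]; rfl
  have hstate : stateAt δ P v e H 0 = e H P.card 1 := by
    rw [stateAt, hH, remaining_zero, counter_zero]
  have hall : stateRobots pos H = Set.univ :=
    Set.eq_of_subset_of_ncard_le (Set.subset_univ _)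
      (by rw [hs.1, Set.ncard_univ, Nat.card_eq_fintype_card, Fintype.card_fin])
  have hrange : Set.range pos = stateAt δ P v e H 0 := by
    rw [hstate, ← hs.2.2, formationState, hall, Set.image_univ]
  constructor
  · rw [← Set.injOn_univ]
    refine Set.injOn_of_ncard_image_eq ?_
    rw [Set.image_univ, hrange, h.ncard_stateAt, remaining_zero, Set.ncard_univ, Nat.card_eq_fintype_card,
      Fintype.card_fin]
  · rw [hrange, configAt, Set.union_eq_left.2]
    intro p hp
    obtain ⟨j, hj, -⟩ := mem_dropped.1 hp
    exact absurd hj (Fin.not_lt_zero j)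

end Traversal

end Drawing

end

theorem mainTheorem5 {k : ℕ} [NeZero k] (P : Finset ℂ) (v : Fin k → ℂ) (ε δ : ℝ)
    (e : Drawing.DrawingHull → ℕ → ℕ → Set ℂ) (H : Drawing.DrawingHull)
    (hε : 0 < ε)
    (he : Drawing.IsStateEnumeration ε e)
    (hv : Drawing.IsDrawingPath δ P v)
    (hanchor : H.anchor = v 0)
    (hdiam : H.diam + ε ≤ 1 - δ)
    (hloc : P.card + 2 ≤ (Drawing.granularLocations ε H).ncard) :
    (Function.Injective fun i : Fin k =>
      (Drawing.remaining δ P v i, Drawing.counter δ P v i)) ∧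
    ∃ A : Drawing.Protocol, ∀ pos : ℕ → Fin P.card → ℂ,
      Drawing.IsExecution A pos →
      Drawing.Compatible ε δ P v (pos 0) H →
      Drawing.IsInState ε e (pos 0) H P.card 1 →
      (∀ i : Fin k, Drawing.IsInState ε e (pos i) (H.moveTo (v i))
        (Drawing.remaining δ P v i) (Drawing.counter δ P v i)) ∧
      (∀ i j : Fin k, (j : ℕ) = i + 1 →
        Drawing.FormationMoves (pos i) (pos j) (H.moveTo (v i)) (v j) ∧
        Set.BijOn (pos j)
          (Drawing.stateRobots (pos i) (H.moveTo (v i)) \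
            Drawing.stateRobots (pos j) (H.moveTo (v j)))
          (Drawing.dropSet δ P v i) ∧
        ∀ r, r ∉ Drawing.stateRobots (pos i) (H.moveTo (v i)) → pos j r = pos i r) := by
  classical
  refine ⟨Drawing.injective_remaining_counter, ?_⟩
  -- The protocol must be fixed before the execution, while compatibility is assumed of the
  -- execution. Traversability mentions no configuration; if it fails, no admissible start exists
  -- and any protocol will do.
  by_cases h : Drawing.IsTraversable ε δ P v e H
  swap
  · refine ⟨⟨fun _ => 0, by simp⟩, fun pos _ hc hs => absurd ?_ h⟩
    exact Drawing.isTraversable_of_compatible hε he hv hdiam hloc hc hs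
  obtain ⟨A, g, hg, hA⟩ := h.exists_protocol_of_step
  refine ⟨A, fun pos hpos _ hs => ?_⟩
  have hstep : ∀ i j : Fin k, (j : ℕ) = i + 1 →
      Set.range (pos i) = Drawing.configAt δ P v e H i → ∀ r, pos j r =
        if pos i r ∈ Drawing.stateAt δ P v e H i then g i (pos i r) else pos i r := by
    intro i j hij hrange r
    obtain ⟨u, hu⟩ := hpos i
    rw [hij, hu]
    exact hA (pos i) u i r hrange
  have hinv : ∀ n, ∀ i : Fin k, (i : ℕ) = n → Function.Injective (pos i) ∧
      Set.range (pos i) = Drawing.configAt δ P v e H i := by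
    intro n
    induction n with
    | zero =>
      intro i hi
      obtain rfl : i = 0 := Fin.ext hi
      exact Drawing.initial_configuration h hanchor hs
    | succ n ih =>
      intro j hj
      obtain ⟨hinj, hrange⟩ := ih ⟨n, by omega⟩ rfl
      have hs := hstep ⟨n, by omega⟩ j hj hrange
      exact ⟨h.injective_step hj hs hrange (hg _ j hj) hinj,
        h.range_step hj hs hrange (hg _ j hj)⟩
  refine ⟨fun i => h.isInState (hinv i i rfl).1 (hinv i i rfl).2, fun i j hij => ?_⟩
  obtain ⟨hinj, hrange⟩ := hinv i i rfl
  exact h.formation_step hij (hstep i j hij hrange) hrange (hg i j hij) hinj
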